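/- Let $k$ be a field, let $p\ge 2$ and $n\ge 0$ be integers, let $R=k[x_1,\dots,x_{p+2}]$ be the polynomial ring and $Q$ its field of fractions. Write $e_1,e_2,\dots$ for standard basis vectors. An element of $\bigwedge^a F^b$ ($F$ a field) is called decomposable if it equals $v_1\wedge\dots\wedge v_a$ for some $v_i\in F^b$; an element of $\bigwedge^a R^b$ is called decomposable if its image in $\bigwedge^a Q^b$ is decomposable. Let $X$ be the $(p+2)\times n$ matrix with $(i,j)$ entry $x_i^{\,j-1}$, and let $Z=(I\ \ O)$ be the $4\times(p+2)$ matrix consisting of the $4\times4$ unit matrix and the $4\times(p-2)$ zero matrix. Let $\delta\colon\bigwedge^pR^{p+2}\to\bigwedge^2R^{p+2}$ be the $R$-linear map with $\delta(e_{i_1}\wedge\dots\wedge e_{i_p})=e_{j_1}\wedge e_{j_2}$ whenever $i_1<\dots<i_p$, $j_1<j_2$ and $\{i_1,\dots,i_p,j_1,j_2\}=\{1,\dots,p+2\}$. Regarding $\bigwedge^pk^n$ as a subset of $\bigwedge^pR^n$, define $$G=\textstyle\bigwedge^2Z\circ\delta\circ\bigwedge^pX\colon\ \bigwedge^pk^n\to\bigwedge^2R^4,$$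 and, writing $G(\omega)=\sum_{1\le i<j\le4}\hat\Pi_{ij}\,e_i\wedge e_j$ with $\hat\Pi_{ij}\in R$, let $$H(\omega)=\hat\Pi_{12}\hat\Pi_{34}-\hat\Pi_{13}\hat\Pi_{24}+\hat\Pi_{14}\hat\Pi_{23}\in R,$$ that is, $H=G^*P_{\{1\}\{2,3,4\}}$ is the pull-back under $G$ of the three-term Plücker relation on $\bigwedge^2$ of a four-dimensional space. Then for every $\omega\in\bigwedge^pk^n$ the following four conditions are equivalent: 1. $\omega$ is decomposable; 2. $\bigwedge^pX(\omega)\in\bigwedge^pR^{p+2}$ is decomposable; 3. $G(\omega)\in\bigwedge^2R^4$ is decomposable; 4. $H(\omega)=0$. -/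

import Mathlib

noncomputable section

namespace GrassmannCone

/-- An element `η` of the `a`-th exterior power of a module is decomposable if it is of the form
`v₁ ∧ ⋯ ∧ v_a`. -/
def IsDecomposable {A M : Type*} [CommRing A] [AddCommGroup M] [Module A M] {a : ℕ}
    (η : ⋀[A]^a M) : Prop :=
  ∃ v : Fin a → M, η = exteriorPower.ιMulti A a v

/-- The alternating map `(v₁, …, v_a) ↦ v₁ ∧ ⋯ ∧ v_a` from vectors with entries in `A` to the
exterior power of `B^b`, for an `A`-algebra `B`. -/
def baseChangeAlternating (A B : Type*) [CommRing A] [CommRing B] [Algebra A B] (a b : ℕ) :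
    (Fin b → A) [⋀^Fin a]→ₗ[A] ⋀[B]^a (Fin b → B) where
  toMultilinearMap :=
    ((exteriorPower.ιMulti B a (M := Fin b → B)).toMultilinearMap.restrictScalars
      A).compLinearMap fun _ => (Algebra.linearMap A B).compLeft (Fin b)
  map_eq_zero_of_eq' v i j hv hij :=
    (exteriorPower.ιMulti B a (M := Fin b → B)).map_eq_zero_of_eq
      (fun l => (Algebra.linearMap A B).compLeft (Fin b) (v l)) (by simp only [hv]) hij

/-- Extension of scalars `⋀^a A^b → ⋀^a B^b` along an `A`-algebra `B`. -/
def baseChange (A B : Type*) [CommRing A] [CommRing B] [Algebra A B] (a b : ℕ) :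
    ⋀[A]^a (Fin b → A) →ₗ[A] ⋀[B]^a (Fin b → B) :=
  exteriorPower.alternatingMapLinearEquiv (baseChangeAlternating A B a b)

theorem baseChange_ιMulti (A B : Type*) [CommRing A] [CommRing B] [Algebra A B] (a b : ℕ)
    (v : Fin a → Fin b → A) :
    baseChange A B a b (exteriorPower.ιMulti A a v) =
      exteriorPower.ιMulti B a fun l j => algebraMap A B (v l j) := by
  rw [baseChange, exteriorPower.alternatingMapLinearEquiv_apply_ιMulti]
  rfl

/-- For an integral domain `A` with field of fractions `Q`, an element of `⋀^a A^b` is called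
decomposable if its image in `⋀^a Q^b` is decomposable. -/
def IsFracDecomposable {A : Type*} [CommRing A] [IsDomain A] {a b : ℕ}
    (η : ⋀[A]^a (Fin b → A)) : Prop :=
  IsDecomposable (baseChange A (FractionRing A) a b η)

/-- The standard basis `e_S` (`S` a `p`-element subset of the index set) of `⋀^p A^m`. -/
def stdBasis (A : Type*) [CommRing A] (p m : ℕ) :
    Module.Basis (Set.powersetCard (Fin m) p) A (⋀[A]^p (Fin m → A)) :=
  (Pi.basisFun A (Fin m)).exteriorPower p

/-- The dual isomorphism `δ : ⋀^p A^(p+q) → ⋀^q A^(p+q)`, the linear map with `δ(e_I) = e_J`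
for `J` the complement of `I` (no sign is introduced). -/
def dualIso (A : Type*) [CommRing A] (p q : ℕ) :
    ⋀[A]^p (Fin (p + q) → A) →ₗ[A] ⋀[A]^q (Fin (p + q) → A) :=
  (stdBasis A p (p + q)).constr A fun I =>
    stdBasis A q (p + q)
      (Set.powersetCard.compl (by rw [Fintype.card_fin, Nat.add_comm]) I)

/-- The coordinate `Π_{ij}` on `⋀² A^m`, antisymmetric in `i` and `j`. -/
def coord₂ {A : Type*} [CommRing A] {m : ℕ} (i j : Fin m) : ⋀[A]^2 (Fin m → A) →ₗ[A] A :=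
  exteriorPower.pairingDual A (Fin m → A) 2
    (exteriorPower.ιMulti A 2 ![LinearMap.proj i, LinearMap.proj j])

theorem coord₂_ιMulti {A : Type*} [CommRing A] {m : ℕ} (i j : Fin m) (v w : Fin m → A) :
    coord₂ i j (exteriorPower.ιMulti A 2 ![v, w]) = v i * w j - v j * w i := by
  simp [coord₂, Matrix.det_fin_two]

/-- For `i < j`, `coord₂ i j` is the coordinate with respect to the basis vector `e_i ∧ e_j`. -/
theorem coord₂_eq_repr {A : Type*} [CommRing A] {m : ℕ} (s : Set.powersetCard (Fin m) 2)
    (η : ⋀[A]^2 (Fin m → A)) :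
    coord₂ (Set.powersetCard.ofFinEmbEquiv.symm s 0) (Set.powersetCard.ofFinEmbEquiv.symm s 1) η =
      (stdBasis A 2 m).repr η s := by
  rw [stdBasis, exteriorPower.basis_repr_apply, exteriorPower.ιMultiDual, coord₂,
    exteriorPower.ιMulti_family]
  congr 3

/-- The three-term Plücker relation
`P_{{1}{2,3,4}} = Π₁₂ Π₃₄ - Π₁₃ Π₂₄ + Π₁₄ Π₂₃` on `⋀² A⁴` (indices shifted to start at `0`). -/
def plucker₄ {A : Type*} [CommRing A] (η : ⋀[A]^2 (Fin 4 → A)) : A :=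
  coord₂ 0 1 η * coord₂ 2 3 η - coord₂ 0 2 η * coord₂ 1 3 η + coord₂ 0 3 η * coord₂ 1 2 η

/-- The polynomial ring `R = k[x₁, …, x_{p+2}]`. -/
abbrev ParamRing (k : Type*) [Field k] (p : ℕ) : Type _ := MvPolynomial (Fin (p + 2)) k

/-- The `(p+2) × n` matrix `X` with `(i, j)` entry `x_i^(j-1)` (columns are indexed from `0` here,
so that the exponent is the index). -/
def matX (k : Type*) [Field k] (p n : ℕ) : Matrix (Fin (p + 2)) (Fin n) (ParamRing k p) :=
  Matrix.of fun i j => MvPolynomial.X i ^ (j : ℕ)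

/-- The `4 × (p+2)` matrix `Z = (I O)`, for `p ≥ 2`. -/
def matZ (A : Type*) [CommRing A] (p : ℕ) : Matrix (Fin 4) (Fin (p + 2)) A :=
  Matrix.of fun i j => if (i : ℕ) = (j : ℕ) then 1 else 0

/-- `⋀^p X`, restricted to `⋀^p k^n` and taking values in `⋀^p R^(p+2)`. -/
def wedgeX (k : Type*) [Field k] (p n : ℕ) (ω : ⋀[k]^p (Fin n → k)) :
    ⋀[ParamRing k p]^p (Fin (p + 2) → ParamRing k p) :=
  exteriorPower.map p (matX k p n).mulVecLin (baseChange k (ParamRing k p) p n ω)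

/-- `G = ⋀² Z ∘ δ ∘ ⋀^p X`, restricted to `⋀^p k^n` and taking values in `⋀² R⁴`. -/
def mapG (k : Type*) [Field k] (p n : ℕ) (ω : ⋀[k]^p (Fin n → k)) :
    ⋀[ParamRing k p]^2 (Fin 4 → ParamRing k p) :=
  exteriorPower.map 2 (matZ (ParamRing k p) p).mulVecLin
    (dualIso (ParamRing k p) p 2 (wedgeX k p n ω))

/-- `H = G^* P_{{1}{2,3,4}}`, with values in `R`. -/
def formH (k : Type*) [Field k] (p n : ℕ) (ω : ⋀[k]^p (Fin n → k)) : ParamRing k p :=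
  plucker₄ (mapG k p n ω)

end GrassmannCone

end

/-! Pairing with dot products turns `ω` into an alternating form, and decomposability becomes being
a multiple of a pulled-back determinant (`IsDetForm`). The implication from 1 to 2 is functoriality,
and 2 gives 4 because determinants satisfy the three-term relations. On `⋀²` of a four-dimensional
space the single relation is also sufficient, which gives 3 ↔ 4.

The weight lies in 4 → 1. The rows of `X` are points of the moment curve with independent
parameters, so `H(ω) = 0` says that the form satisfies a three-term relation at a generic tuple of
such points. Specialising the variables gives every three-term relation on the curve over the
algebraic closure (`threeTerm_of_formH_eq_zero`). The curve still spans after a proper subspace is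
removed (`isGenericSet_momentCurve`), and this allows induction on the degree. In degree two,
multilinearity extends the relation to all vectors. In higher degree, contractions with points of
the curve are decomposable by induction, and `isDetForm_of_curryLeft` recovers the form. Finally
`isDetForm_descend` returns to `k`. -/

noncomputable section

namespace GrassmannCone

open Matrix exteriorPower

/-! ### Determinantal forms and exchange relations -/

section Forms

/-- The three-term Plücker relation. -/
def ThreeTerm {A V : Type*} [CommRing A] [AddCommGroup V] [Module A V] {p : ℕ}
    (ω : V [⋀^Fin (p + 2)]→ₗ[A] A) (S : Fin p → V) (a b c d : V) : Prop :=
  ω (vecCons a (vecCons b S)) * ω (vecCons c (vecCons d S)) -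
    ω (vecCons a (vecCons c S)) * ω (vecCons b (vecCons d S)) +
    ω (vecCons a (vecCons d S)) * ω (vecCons b (vecCons c S)) = 0

variable {K V : Type*} [Field K] [AddCommGroup V] [Module K V]

/-- An alternating form is totally decomposable if it is a multiple of the pull-back of the
determinant along a linear map to the coordinate space. -/
def IsDetForm {p : ℕ} (ω : V [⋀^Fin p]→ₗ[K] K) : Prop :=
  ∃ (c : K) (φ : V →ₗ[K] Fin p → K), ∀ y, ω y = c * (Matrix.of fun i => φ (y i)).det

/-- The single-exchange Plücker relations for the frame `e`. -/
def ExchangeAt {p : ℕ} (ω : V [⋀^Fin (p + 1)]→ₗ[K] K) (e : Fin (p + 1) → V) : Prop :=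
  ∀ (v : V) (w : Fin p → V),
    ω e * ω (vecCons v w) = ∑ i, ω (Function.update e i v) * ω (vecCons (e i) w)

theorem alternatingMap_sum_apply {ι : Type*} {p : ℕ} (s : Finset ι) (f : ι → V [⋀^Fin p]→ₗ[K] K)
    (y : Fin p → V) : (∑ i ∈ s, f i) y = ∑ i ∈ s, f i y := by
  classical
  induction s using Finset.induction_on with
  | empty => simp
  | insert j s hj ih => simp [Finset.sum_insert hj, ih]

theorem map_cons_cons_swap {p : ℕ} (ω : V [⋀^Fin (p + 2)]→ₗ[K] K) (S : Fin p → V) (a b : V) :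
    ω (vecCons b (vecCons a S)) = - ω (vecCons a (vecCons b S)) := by
  rw [← ω.map_swap _ (i := 0) (j := 1) (by simp)]
  congr 1
  ext i
  refine Fin.cases ?_ (fun i => Fin.cases ?_ (fun i => ?_) i) i
  · simp
  · simp
  · rw [Function.comp_apply, Equiv.swap_apply_of_ne_of_ne] <;> simp [Fin.ext_iff]

theorem isDetForm_zero {p : ℕ} : IsDetForm (0 : V [⋀^Fin p]→ₗ[K] K) :=
  ⟨0, 0, fun y => by simp⟩

/-- This is Cramer's rule for `φ v` in terms of the `φ (e i)`, substituted into the first slot of a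
determinant whose other rows are the `φ (w i)`. -/
theorem IsDetForm.exchangeAt {p : ℕ} {ω : V [⋀^Fin (p + 1)]→ₗ[K] K} (h : IsDetForm ω)
    (e : Fin (p + 1) → V) : ExchangeAt ω e := by
  obtain ⟨c, φ, h⟩ := h
  intro v w
  let A : Matrix (Fin (p + 1)) (Fin (p + 1)) K := (Matrix.of fun i => φ (e i))ᵀ
  have key := congrArg (fun x => (detRowAlternating (n := Fin (p + 1)) (R := K)).curryLeft x
    (fun i => φ (w i))) (mulVec_cramer A (φ v))
  have hA : A *ᵥ cramer A (φ v) = ∑ i, cramer A (φ v) i • φ (e i) := by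
    ext j
    simp [A, mulVec, dotProduct, mul_comm]
  have hcons : ∀ x, ω (vecCons x w) =
      c * (detRowAlternating (n := Fin (p + 1)) (R := K)).curryLeft (φ x) (fun i => φ (w i)) := by
    intro x
    rw [h]
    congr 1
    rw [AlternatingMap.curryLeft_apply_apply]
    change _ = Matrix.det _
    congr 1
    ext i j
    refine Fin.cases ?_ (fun i => ?_) i <;> simp
  have hupd : ∀ i, ω (Function.update e i v) = c * cramer A (φ v) i := by
    intro i
    rw [h, cramer_apply, ← det_transpose]
    congr 2
    ext j l
    simp only [transpose_apply, of_apply, A, updateCol_apply, Function.update_apply]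
    split_ifs <;> rfl
  have hdet : ω e = c * A.det := by rw [h, ← det_transpose]
  rw [hA] at key
  simp only [map_sum, map_smul, alternatingMap_sum_apply, AlternatingMap.smul_apply,
    smul_eq_mul] at key
  simp only [hcons, hupd, hdet]
  calc _ = c * c * (A.det * (detRowAlternating (n := Fin (p + 1)) (R := K)).curryLeft (φ v)
        (fun i => φ (w i))) := by ring
    _ = _ := by
        rw [← key, Finset.mul_sum]
        exact Finset.sum_congr rfl fun i _ => by ring

theorem map_eq_zero_of_curryLeft_eq_zero {p : ℕ} {ω : V [⋀^Fin (p + 1)]→ₗ[K] K}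
    {y : Fin (p + 1) → V} (j : Fin (p + 1)) (h : ω.curryLeft (y j) = 0) : ω y = 0 := by
  by_cases hj : j = 0
  · subst hj
    have := DFunLike.congr_fun h (vecTail y)
    simpa [AlternatingMap.curryLeft_apply_apply, vecHead] using
      (congrArg ω (cons_head_tail y)).symm.trans this
  · have h1 := ω.map_swap y (i := 0) (j := j) (Ne.symm hj)
    have := DFunLike.congr_fun h (vecTail (y ∘ Equiv.swap 0 j))
    have h2 : ω (y ∘ Equiv.swap 0 j) = 0 := by
      rw [← cons_head_tail (y ∘ Equiv.swap 0 j)]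
      simpa [vecHead] using this
    rw [h2] at h1
    simpa using h1.symm

/-- Let `φ` take Cramer coordinates in the frame `e`. The exchange relations say that `v` and its
reconstruction `L (φ v)` differ by a vector contracting `ω` to zero. Hence `ω` factors through `φ`,
and a top-degree form on the coordinate space is a multiple of the determinant. -/
theorem isDetForm_of_exchangeAt {p : ℕ} {ω : V [⋀^Fin (p + 1)]→ₗ[K] K} {e : Fin (p + 1) → V}
    (he : ω e ≠ 0) (h : ExchangeAt ω e) : IsDetForm ω := by
  let φ : V →ₗ[K] Fin (p + 1) → K :=
    LinearMap.pi fun i => (ω e)⁻¹ • ω.toMultilinearMap.toLinearMap e i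
  have hφ : ∀ v i, φ v i = (ω e)⁻¹ * ω (Function.update e i v) := fun v i => rfl
  let L : (Fin (p + 1) → K) →ₗ[K] V := Fintype.linearCombination K e
  have hL : ∀ x, L x = ∑ i, x i • e i := fun x => Fintype.linearCombination_apply K e x
  have hker : ∀ v, ω.curryLeft (v - L (φ v)) = 0 := by
    intro v
    ext w
    have := h v w
    rw [hL, map_sub, AlternatingMap.sub_apply, map_sum, alternatingMap_sum_apply,
      AlternatingMap.zero_apply, sub_eq_zero, AlternatingMap.curryLeft_apply_apply]
    simp only [map_smul, AlternatingMap.smul_apply, AlternatingMap.curryLeft_apply_apply, hφ,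
      smul_eq_mul, mul_assoc, ← Finset.mul_sum]
    rw [← this, ← mul_assoc, inv_mul_cancel₀ he, one_mul]
  have hproj : ∀ y, ω y = ω fun i => L (φ (y i)) := by
    intro y
    -- The arguments are replaced one at a time.
    have : ∀ s : Finset (Fin (p + 1)), ω (s.piecewise (fun i => L (φ (y i))) y) = ω y := by
      intro s
      induction s using Finset.induction_on with
      | empty => simp
      | insert j s hj ih =>
        rw [Finset.piecewise_insert, ← ih]
        have h1 := ω.map_update_sub (s.piecewise (fun i => L (φ (y i))) y) j (y j) (L (φ (y j)))
        rw [map_eq_zero_of_curryLeft_eq_zero j (by simpa using hker (y j))] at h1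
        have h2 : Function.update (s.piecewise (fun i => L (φ (y i))) y) j (y j) =
            s.piecewise (fun i => L (φ (y i))) y := by
          rw [Function.update_eq_self_iff]
          simp [hj]
        rw [h2] at h1
        exact (sub_eq_zero.mp h1.symm).symm
    have h3 := this Finset.univ
    rw [Finset.piecewise_univ] at h3
    exact h3.symm
  refine ⟨ω e, φ, fun y => ?_⟩
  rw [hproj]
  have h4 := DFunLike.congr_fun
    (AlternatingMap.eq_smul_basis_det (Pi.basisFun K (Fin (p + 1))) (ω.compLinearMap L))
    (fun i => φ (y i))
  rw [AlternatingMap.smul_apply, Module.Basis.det_apply] at h4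
  have h5 : (ω.compLinearMap L) (Pi.basisFun K (Fin (p + 1))) = ω e := by
    rw [AlternatingMap.compLinearMap_apply]
    congr 1
    ext i
    simp [hL, Pi.single_apply]
  rw [h5] at h4
  refine h4.trans ?_
  rw [smul_eq_mul, ← det_transpose]
  rfl

/-- Exchange `c` into the frame `(a, b, S)` against `(d, S)`: the terms moving a vector of `S`
vanish by repetition. -/
theorem IsDetForm.threeTerm {p : ℕ} {ω : V [⋀^Fin (p + 2)]→ₗ[K] K} (h : IsDetForm ω)
    (S : Fin p → V) (a b c d : V) : ThreeTerm ω S a b c d := by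
  have h1 := h.exchangeAt (vecCons a (vecCons b S)) c (vecCons d S)
  have h2 : ∀ i, ω (vecCons (S i) (vecCons d S)) = 0 := fun i =>
    ω.map_eq_zero_of_eq _ (i := 0) (j := i.succ.succ) (by simp) (by simp [Fin.ext_iff])
  have h3 : Function.update (vecCons a (vecCons b S)) 0 c = vecCons c (vecCons b S) := by
    ext i
    refine Fin.cases ?_ (fun i => ?_) i <;> simp
  have h4 : Function.update (vecCons a (vecCons b S)) 1 c = vecCons a (vecCons c S) := by
    ext i
    refine Fin.cases ?_ (fun i => Fin.cases ?_ (fun i => ?_) i) i <;>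
      simp [Fin.ext_iff]
  have h5 := map_cons_cons_swap ω S b c
  have h6 : vecCons a (vecCons b S) 1 = b := rfl
  rw [Fin.sum_univ_succ, Fin.sum_univ_succ] at h1
  simp only [cons_val_zero, cons_val_succ, h2, mul_zero, Finset.sum_const_zero, add_zero,
    Fin.succ_zero_eq_one, h3, h4, h5, h6] at h1
  unfold ThreeTerm
  linear_combination h1

end Forms

/-! ### Reduction to a generic set of vectors by contraction -/

section Generic

variable {K V : Type*} [Field K] [AddCommGroup V] [Module K V]

/-- A set of vectors is generic if it still spans after removing any proper subspace. -/
def IsGenericSet (K : Type*) {V : Type*} [Field K] [AddCommGroup V] [Module K V]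
    (C : Set V) : Prop :=
  ∀ W : Submodule K V, W ≠ ⊤ → Submodule.span K (C \ (W : Set V)) = ⊤

theorem IsGenericSet.exists_apply_ne_zero {C : Set V} (hC : IsGenericSet K C) {N : Type*}
    [AddCommGroup N] [Module K N] {f : V →ₗ[K] N} (hf : f ≠ 0) : ∃ s ∈ C, f s ≠ 0 := by
  by_contra! h
  have h1 := hC (LinearMap.ker f) (by rwa [Ne, LinearMap.ker_eq_top])
  have h2 : C \ (LinearMap.ker f : Set V) = ∅ := by
    ext x
    simpa using h x
  rw [h2, Submodule.span_empty] at h1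
  apply hf
  rw [← LinearMap.ker_eq_top, eq_top_iff, ← h1]
  exact bot_le

theorem exists_apply_ne_zero_of_ne_zero {p : ℕ} {ω : V [⋀^Fin p]→ₗ[K] K} (h : ω ≠ 0) :
    ∃ y, ω y ≠ 0 := by
  by_contra! h1
  exact h (AlternatingMap.ext h1)

theorem curryLeft_ne_zero {p : ℕ} {ω : V [⋀^Fin (p + 1)]→ₗ[K] K} (h : ω ≠ 0) :
    ω.curryLeft ≠ 0 := by
  obtain ⟨y, hy⟩ := exists_apply_ne_zero_of_ne_zero h
  intro h1
  exact hy (map_eq_zero_of_curryLeft_eq_zero 0 (by rw [h1]; rfl))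

/-- If `s` contracts to zero with `u` in a decomposable form, then a multiple of `s` is congruent
to a multiple of `u` modulo the kernel of the form. -/
theorem IsDetForm.exists_smul_sub_smul_mem_ker {p : ℕ} {η : V [⋀^Fin (p + 1)]→ₗ[K] K}
    (h : IsDetForm η) {u s : V} {y : Fin p → V}
    (hs : ∀ z i, z i = s → η (vecCons u z) = 0) :
    η.curryLeft (η (vecCons u y) • s - η (vecCons s y) • u) = 0 := by
  ext w
  have h1 := h.exchangeAt (vecCons u y) s w
  rw [Fin.sum_univ_succ] at h1
  have h2 : Function.update (vecCons u y) 0 s = vecCons s y := by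
    ext i
    refine Fin.cases ?_ (fun i => ?_) i <;> simp
  -- Exchanging `s` into a slot of `y` leaves it together with `u`, so only the exchange with `u`
  -- survives.
  have h3 : ∀ i : Fin p, η (Function.update (vecCons u y) i.succ s) = 0 := by
    intro i
    have : Function.update (vecCons u y) i.succ s = vecCons u (Function.update y i s) := by
      ext j
      refine Fin.cases ?_ (fun j => ?_) j
      · simp [Fin.ext_iff]
      · simp [Function.update_apply]
    rw [this]
    exact hs _ i (by simp)
  simp only [h3, zero_mul, Finset.sum_const_zero, add_zero, h2, cons_val_zero] at h1
  simp only [map_sub, map_smul, AlternatingMap.sub_apply, AlternatingMap.smul_apply,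
    AlternatingMap.curryLeft_apply_apply, smul_eq_mul, AlternatingMap.zero_apply]
  linear_combination h1

theorem curryLeft_curryLeft_swap {p : ℕ} (ω : V [⋀^Fin (p + 2)]→ₗ[K] K) (a b : V) :
    (ω.curryLeft a).curryLeft b = - (ω.curryLeft b).curryLeft a := by
  ext S
  exact map_cons_cons_swap ω S b a

/-- A vector `u` killed by the contractions with `s` and `t` is killed by the contraction with
every `r` outside the kernel of the contraction with `s` and `t`. -/
theorem curryLeft_curryLeft_eq_zero {q : ℕ} {ω : V [⋀^Fin (q + 3)]→ₗ[K] K} {r s t u : V}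
    (hr : IsDetForm (ω.curryLeft r)) (hsu : (ω.curryLeft s).curryLeft u = 0)
    (htu : (ω.curryLeft t).curryLeft u = 0)
    (hst : ((ω.curryLeft s).curryLeft t).curryLeft r ≠ 0) :
    (ω.curryLeft r).curryLeft u = 0 := by
  by_contra hne
  obtain ⟨y, hy⟩ := exists_apply_ne_zero_of_ne_zero hne
  rw [AlternatingMap.curryLeft_apply_apply] at hy
  have key : ∀ x, (ω.curryLeft x).curryLeft u = 0 → ∀ (z : Fin (q + 1) → V) (i : Fin (q + 1)),
      z i = x → ω.curryLeft r (vecCons u z) = 0 := by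
    intro x hx z i hi
    rw [← AlternatingMap.curryLeft_apply_apply]
    apply map_eq_zero_of_curryLeft_eq_zero i
    rw [hi, curryLeft_curryLeft_swap, curryLeft_curryLeft_swap ω r x]
    simp only [← AlternatingMap.curryLeftLinearMap_apply, map_neg, LinearMap.neg_apply, neg_neg]
    simp only [AlternatingMap.curryLeftLinearMap_apply]
    rw [curryLeft_curryLeft_swap, hx]
    simp
  have h1 := hr.exists_smul_sub_smul_mem_ker (y := y) (key s hsu)
  have h2 := hr.exists_smul_sub_smul_mem_ker (y := y) (key t htu)
  set l := ω.curryLeft r (vecCons u y)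
  set a := ω.curryLeft r (vecCons s y)
  set b := ω.curryLeft r (vecCons t y)
  -- Both `s` and `t` are proportional to `u` modulo the kernel of `ω.curryLeft r`; eliminating `u`
  -- makes them dependent there. This forces contraction with `r`, `s` and `t` to vanish,
  -- contradicting `hst`.
  have h3 : (ω.curryLeft r).curryLeft (l • (a • t - b • s)) = 0 := by
    have : l • (a • t - b • s) = a • (l • t - b • u) - b • (l • s - a • u) := by module
    rw [this, map_sub, map_smul, map_smul, h1, h2]
    simp
  rw [map_smul, smul_eq_zero_iff_right hy, map_sub, map_smul, map_smul, sub_eq_zero] at h3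
  have h4 := congrArg (fun f => f.curryLeft s) h3
  simp only [AlternatingMap.curryLeft_smul, LinearMap.smul_apply, AlternatingMap.curryLeft_same,
    smul_zero] at h4
  rcases smul_eq_zero.mp h4 with h5 | h5
  · rw [h5, zero_smul, sub_zero, map_smul, smul_eq_zero_iff_right hy] at h1
    apply hst
    rw [curryLeft_curryLeft_swap, curryLeft_curryLeft_swap ω s r, h1]
    simp
  · apply hst
    rw [curryLeft_curryLeft_swap, curryLeft_curryLeft_swap ω s r]
    simp only [← AlternatingMap.curryLeftLinearMap_apply, map_neg, LinearMap.neg_apply, neg_neg]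
    simp only [AlternatingMap.curryLeftLinearMap_apply]
    rw [curryLeft_curryLeft_swap, h5, neg_zero]

/-- The defect of expanding `v` in terms of the frame `e` by Cramer's rule. -/
def frameDefect {p : ℕ} (ω : V [⋀^Fin (p + 1)]→ₗ[K] K) (e : Fin (p + 1) → V) (v : V) : V :=
  ω e • v - ∑ i, ω (Function.update e i v) • e i

theorem exchangeAt_of_frameDefect {p : ℕ} {ω : V [⋀^Fin (p + 1)]→ₗ[K] K} {e : Fin (p + 1) → V}
    (h : ∀ v, ω.curryLeft (frameDefect ω e v) = 0) : ExchangeAt ω e := by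
  intro v w
  have := DFunLike.congr_fun (h v) w
  rw [frameDefect, map_sub, map_smul, map_sum, AlternatingMap.sub_apply, alternatingMap_sum_apply,
    AlternatingMap.zero_apply, sub_eq_zero] at this
  simpa using this

/-- The term of the defect along `s` dies on contraction with `s`; what remains is the exchange
relation of `ω.curryLeft s` for the frame `y`. -/
theorem curryLeft_frameDefect {p : ℕ} {ω : V [⋀^Fin (p + 2)]→ₗ[K] K} {s : V}
    (h : IsDetForm (ω.curryLeft s)) (y : Fin (p + 1) → V) (v : V) :
    (ω.curryLeft s).curryLeft (frameDefect ω (vecCons s y) v) = 0 := by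
  ext w
  have h1 := h.exchangeAt y v w
  rw [frameDefect, map_sub, map_smul, map_sum, AlternatingMap.sub_apply, alternatingMap_sum_apply,
    AlternatingMap.zero_apply, sub_eq_zero, Fin.sum_univ_succ]
  have h2 : ∀ i : Fin (p + 1), Function.update (vecCons s y) i.succ v =
      vecCons s (Function.update y i v) := by
    intro i
    ext j
    refine Fin.cases ?_ (fun j => ?_) j
    · exact Function.update_of_ne (Fin.succ_ne_zero _).symm _ _
    · simp [Function.update_apply]
  simpa [h2] using h1

theorem frameDefect_comp_swap {p : ℕ} (ω : V [⋀^Fin (p + 2)]→ₗ[K] K) (e : Fin (p + 2) → V)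
    (v : V) : frameDefect ω (e ∘ Equiv.swap 0 1) v = - frameDefect ω e v := by
  have h1 : ∀ f : Fin (p + 2) → V, ω (f ∘ Equiv.swap 0 1) = - ω f := fun f =>
    ω.map_swap f (by simp)
  have h2 : ∀ i, Function.update (e ∘ Equiv.swap 0 1) i v =
      Function.update e (Equiv.swap 0 1 i) v ∘ Equiv.swap 0 1 := by
    intro i
    rw [Function.update_comp_equiv]
    simp
  simp only [frameDefect, h1, h2, Function.comp_apply, neg_smul, Finset.sum_neg_distrib]
  rw [Equiv.sum_comp (Equiv.swap 0 1) fun i => ω (Function.update e i v) • e i]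
  abel

/-- A form of degree at least three is decomposable if its contractions with the elements of a
generic set are. -/
theorem isDetForm_of_curryLeft {q : ℕ} {C : Set V} (hC : IsGenericSet K C)
    (ω : V [⋀^Fin (q + 3)]→ₗ[K] K) (h : ∀ s ∈ C, IsDetForm (ω.curryLeft s)) : IsDetForm ω := by
  by_cases hω : ω = 0
  · rw [hω]
    exact isDetForm_zero
  obtain ⟨s, hsC, hs⟩ := hC.exists_apply_ne_zero (curryLeft_ne_zero hω)
  obtain ⟨t, htC, ht⟩ := hC.exists_apply_ne_zero (curryLeft_ne_zero hs)
  obtain ⟨y, hy⟩ := exists_apply_ne_zero_of_ne_zero ht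
  simp only [AlternatingMap.curryLeft_apply_apply] at hy
  apply isDetForm_of_exchangeAt hy
  apply exchangeAt_of_frameDefect
  intro v
  set u := frameDefect ω (vecCons s (vecCons t y)) v with hu
  have hsu : (ω.curryLeft s).curryLeft u = 0 := curryLeft_frameDefect (h s hsC) _ _
  have htu : (ω.curryLeft t).curryLeft u = 0 := by
    -- Swapping `s` and `t` in the frame only changes the sign of the defect, so `t` plays the same
    -- role as `s`.
    have h1 := curryLeft_frameDefect (h t htC) (vecCons s y) v
    have h2 : (vecCons t (vecCons s y)) = vecCons s (vecCons t y) ∘ Equiv.swap 0 1 := by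
      ext i
      refine Fin.cases ?_ (fun i => Fin.cases ?_ (fun i => ?_) i) i
      · simp
      · simp
      · rw [Function.comp_apply, Equiv.swap_apply_of_ne_of_ne (Fin.succ_ne_zero _)
          (show i.succ.succ ≠ (1 : Fin (q + 3)) from
            (Fin.succ_injective _).ne (Fin.succ_ne_zero i))]
        rfl
    rw [h2, frameDefect_comp_swap, map_neg, neg_eq_zero] at h1
    exact h1
  have hf : (ω.curryLeft u).curryLeft = 0 := by
    -- By genericity, the elements of `C` outside this kernel span, so it suffices to contract with
    -- those.
    have hW := hC (LinearMap.ker ((ω.curryLeft s).curryLeft t).curryLeft)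
      (by rw [Ne, LinearMap.ker_eq_top]; exact curryLeft_ne_zero ht)
    refine LinearMap.ext_on hW fun r hr => ?_
    have := curryLeft_curryLeft_eq_zero (h r hr.1) hsu htu hr.2
    rw [curryLeft_curryLeft_swap, this]
    simp
  by_contra hne
  exact curryLeft_ne_zero hne hf

/-- The relation is linear in each of the four vectors, and a cyclic rotation only changes its sign,
so linearity in the first slot is enough. -/
theorem ThreeTerm.of_span {p : ℕ} {ω : V [⋀^Fin (p + 2)]→ₗ[K] K} {S : Fin p → V} {C : Set V}
    (hC : Submodule.span K C = ⊤) (h : ∀ a ∈ C, ∀ b ∈ C, ∀ c ∈ C, ∀ d ∈ C, ThreeTerm ω S a b c d)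
    (a b c d : V) : ThreeTerm ω S a b c d := by
  have add : ∀ (x y : V) (w : Fin (p + 1) → V),
      ω (vecCons (x + y) w) = ω (vecCons x w) + ω (vecCons y w) := fun x y w =>
    ω.map_vecCons_add w x y
  have smul : ∀ (k : K) (x : V) (w : Fin (p + 1) → V),
      ω (vecCons (k • x) w) = k * ω (vecCons x w) := fun k x w =>
    ω.map_vecCons_smul w k x
  have zero : ∀ w : Fin (p + 1) → V, ω (vecCons 0 w) = 0 := fun w => by
    simpa using smul 0 0 w
  have swap := map_cons_cons_swap ω S
  have top : ∀ x : V, x ∈ Submodule.span K C := fun x => hC ▸ Submodule.mem_top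
  have first : ∀ b c d : V, (∀ a ∈ C, ThreeTerm ω S a b c d) → ∀ a, ThreeTerm ω S a b c d := by
    intro b c d h a
    induction top a using Submodule.span_induction with
    | mem x hx => exact h x hx
    | zero => simp [ThreeTerm, zero]
    | add x y _ _ hx hy =>
      unfold ThreeTerm at *
      simp only [add]
      linear_combination hx + hy
    | smul k x _ hx =>
      unfold ThreeTerm at *
      simp only [smul]
      linear_combination k * hx
  have rot : ∀ a b c d, ThreeTerm ω S a b c d → ThreeTerm ω S b c d a := by
    intro a b c d h
    unfold ThreeTerm at *
    rw [swap a d, swap a c, swap a b]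
    linear_combination -h
  refine first b c d (fun a ha => ?_) a
  refine rot d a b c (rot c d a b (rot b c d a (first c d a (fun b hb => ?_) b)))
  refine rot a b c d (rot d a b c (rot c d a b (first d a b (fun c hc => ?_) c)))
  refine rot b c d a (rot a b c d (rot d a b c (first a b c (fun d hd => ?_) d)))
  exact rot c d a b (rot b c d a (rot a b c d (h a ha b hb c hc d hd)))

/-- In degree two the three-term relation is already the full exchange relation. -/
theorem isDetForm_of_forall_threeTerm {ω : V [⋀^Fin 2]→ₗ[K] K}
    (h : ∀ a b c d, ThreeTerm ω ![] a b c d) : IsDetForm ω := by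
  by_cases hω : ω = 0
  · rw [hω]
    exact isDetForm_zero
  obtain ⟨e, he⟩ := exists_apply_ne_zero_of_ne_zero hω
  refine isDetForm_of_exchangeAt he fun v w => ?_
  have h1 := h (e 0) (e 1) v (w 0)
  have eta2 : ∀ f : Fin 2 → V, vecCons (f 0) (vecCons (f 1) ![]) = f := fun f => by
    ext i; fin_cases i <;> rfl
  have etaw : w = ![w 0] := by ext i; fin_cases i; rfl
  have u0 : Function.update e 0 v = ![v, e 1] := by ext i; fin_cases i <;> simp
  have u1 : Function.update e 1 v = ![e 0, v] := by ext i; fin_cases i <;> simp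
  rw [Fin.sum_univ_two, u0, u1, etaw]
  unfold ThreeTerm at h1
  rw [eta2 e] at h1
  have h2 := map_cons_cons_swap ω ![] (e 1) v
  rw [h2]
  linear_combination h1

/-- A form of degree at least two is decomposable if it satisfies the three-term Plücker relations
on a generic set. -/
theorem isDetForm_of_threeTerm_generic {C : Set V} (hC : IsGenericSet K C)
    (hspan : Submodule.span K C = ⊤) : ∀ {q : ℕ} (ω : V [⋀^Fin (q + 2)]→ₗ[K] K),
    (∀ S : Fin q → V, (∀ i, S i ∈ C) → ∀ a ∈ C, ∀ b ∈ C, ∀ c ∈ C, ∀ d ∈ C,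
      ThreeTerm ω S a b c d) → IsDetForm ω
  | 0, _, h => isDetForm_of_forall_threeTerm (ThreeTerm.of_span hspan (h ![] (fun i => i.elim0)))
  | q + 1, ω, h => by
    refine isDetForm_of_curryLeft hC ω fun s hs => ?_
    refine isDetForm_of_threeTerm_generic hC hspan (ω.curryLeft s) ?_
    intro S hS a ha b hb c hc d hd
    have h1 := h (vecCons s S) (Fin.cases hs hS) a ha b hb c hc d hd
    -- Moving `s` past two vectors costs no sign.
    have h2 : ∀ x y : V, ω.curryLeft s (vecCons x (vecCons y S)) =
        ω (vecCons x (vecCons y (vecCons s S))) := by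
      intro x y
      have e1 := map_cons_cons_swap ω (vecCons y S) x s
      have e2 := map_cons_cons_swap (ω.curryLeft x) S y s
      simp only [AlternatingMap.curryLeft_apply_apply] at e2 ⊢
      rw [e1, e2, neg_neg]
    unfold ThreeTerm at *
    simpa only [h2] using h1

end Generic

/-! ### Exterior powers as alternating forms -/

section ToForm

/-- An element of `⋀^a A^b`, viewed as an alternating form on `B^b` for an `A`-algebra `B`. -/
def toForm (A B : Type*) [CommRing A] [CommRing B] [Algebra A B] {a b : ℕ}
    (ω : ⋀[A]^a (Fin b → A)) : (Fin b → B) [⋀^Fin a]→ₗ[B] B :=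
  ((pairingDual B (Fin b → B) a).flip (baseChange A B a b ω)).compAlternatingMap
    ((ιMulti B a).compLinearMap (dotProductBilin B B))

variable {A : Type*} [CommRing A] {a b : ℕ}

theorem toForm_apply (B : Type*) [CommRing B] [Algebra A B] (ω : ⋀[A]^a (Fin b → A))
    (y : Fin a → Fin b → B) :
    toForm A B ω y = pairingDual B (Fin b → B) a
      (ιMulti B a fun i => dotProductBilin B B (y i)) (baseChange A B a b ω) := rfl

theorem toForm_ιMulti (B : Type*) [CommRing B] [Algebra A B] (v : Fin a → Fin b → A)
    (y : Fin a → Fin b → B) :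
    toForm A B (ιMulti A a v) y =
      (Matrix.of fun i j => y j ⬝ᵥ fun l => algebraMap A B (v i l)).det := by
  rw [toForm_apply, baseChange_ιMulti, pairingDual_ιMulti_ιMulti]
  rfl

theorem toForm_add (B : Type*) [CommRing B] [Algebra A B] (ω η : ⋀[A]^a (Fin b → A))
    (y : Fin a → Fin b → B) : toForm A B (ω + η) y = toForm A B ω y + toForm A B η y := by
  simp [toForm_apply]

theorem toForm_zero (B : Type*) [CommRing B] [Algebra A B] (y : Fin a → Fin b → B) :
    toForm A B (0 : ⋀[A]^a (Fin b → A)) y = 0 := by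
  simp [toForm_apply]

theorem toForm_smul (B : Type*) [CommRing B] [Algebra A B] (r : A) (ω : ⋀[A]^a (Fin b → A))
    (y : Fin a → Fin b → B) : toForm A B (r • ω) y = algebraMap A B r * toForm A B ω y := by
  rw [toForm_apply, toForm_apply, map_smul, ← algebraMap_smul B r, map_smul, smul_eq_mul]

theorem exteriorPower_induction {M : Type*} [AddCommGroup M] [Module A M]
    {P : ⋀[A]^a M → Prop} (h : ∀ v, P (ιMulti A a v)) (h0 : P 0)
    (hadd : ∀ x y, P x → P y → P (x + y)) (hsmul : ∀ (r : A) x, P x → P (r • x))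
    (ω : ⋀[A]^a M) : P ω := by
  have hω : ω ∈ Submodule.span A (Set.range (ιMulti A a (M := M))) := by
    rw [ιMulti_span]
    exact Submodule.mem_top
  induction hω using Submodule.span_induction with
  | mem x hx => obtain ⟨v, rfl⟩ := hx; exact h v
  | zero => exact h0
  | add x y _ _ hx hy => exact hadd x y hx hy
  | smul r x _ hx => exact hsmul r x hx

/-- This naturality permits specialising polynomial variables and descending identities along
injective maps. -/
theorem map_toForm {B C : Type*} [CommRing B] [Algebra A B] [CommRing C] [Algebra A C]
    (f : B →ₐ[A] C) (ω : ⋀[A]^a (Fin b → A)) (y : Fin a → Fin b → B) :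
    f (toForm A B ω y) = toForm A C ω fun i j => f (y i j) := by
  induction ω using exteriorPower_induction with
  | h v =>
    rw [toForm_ιMulti, toForm_ιMulti, AlgHom.map_det]
    congr 1
    ext i j
    simp [dotProduct]
  | h0 => simp only [toForm_zero, map_zero]
  | hadd x y hx hy => simp only [toForm_add, map_add, hx, hy]
  | hsmul r x hx => simp only [toForm_smul, map_mul, hx, AlgHom.commutes]

theorem toForm_baseChange (B : Type*) [CommRing B] [Algebra A B] (ω : ⋀[A]^a (Fin b → A)) :
    toForm B B (baseChange A B a b ω) = toForm A B ω := by
  ext y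
  induction ω using exteriorPower_induction with
  | h v =>
    rw [baseChange_ιMulti, toForm_ιMulti, toForm_ιMulti]
    rfl
  | h0 => simp only [toForm_zero, map_zero]
  | hadd x y hx hy => simp only [toForm_add, map_add, hx, hy]
  | hsmul r x hx =>
    rw [toForm_smul, map_smul, ← algebraMap_smul B r, toForm_smul, hx]
    rfl

theorem toForm_map {c : ℕ} (N : Matrix (Fin c) (Fin b) A) (ω : ⋀[A]^a (Fin b → A))
    (y : Fin a → Fin c → A) :
    toForm A A (exteriorPower.map a N.mulVecLin ω) y = toForm A A ω fun i => y i ᵥ* N := by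
  induction ω using exteriorPower_induction with
  | h v =>
    rw [map_apply_ιMulti, toForm_ιMulti, toForm_ιMulti]
    congr 1
    ext i j
    exact dotProduct_mulVec (y j) N (v i)
  | h0 => simp only [toForm_zero, map_zero]
  | hadd x y hx hy => simp only [toForm_add, map_add, hx, hy]
  | hsmul r x hx => simp only [toForm_smul, map_smul, hx]

theorem toForm_self_apply (ω : ⋀[A]^a (Fin b → A)) (y : Fin a → Fin b → A) :
    toForm A A ω y = pairingDual A (Fin b → A) a
      (ιMulti A a fun i => dotProductBilin A A (y i)) ω := by
  induction ω using exteriorPower_induction with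
  | h v => rw [toForm_ιMulti, pairingDual_ιMulti_ιMulti]; rfl
  | h0 => simp only [toForm_zero, map_zero]
  | hadd x y hx hy => simp only [toForm_add, map_add, hx, hy]
  | hsmul r x hx => rw [toForm_smul, map_smul, hx]; rfl

theorem stdBasis_repr (ω : ⋀[A]^a (Fin b → A)) (s : Set.powersetCard (Fin b) a) :
    (stdBasis A a b).repr ω s =
      toForm A A ω fun i => Pi.single (Set.powersetCard.ofFinEmbEquiv.symm s i) 1 := by
  rw [stdBasis, basis_repr_apply, toForm_self_apply, ιMultiDual, ιMulti_family]
  congr 3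
  ext i x
  simp [dotProductBilin]

theorem toForm_injective : Function.Injective (toForm A A (a := a) (b := b)) := by
  intro ω η h
  apply (stdBasis A a b).repr.injective
  ext s
  rw [stdBasis_repr, stdBasis_repr, h]

theorem coord₂_eq_toForm (i j : Fin b) (η : ⋀[A]^2 (Fin b → A)) :
    coord₂ i j η = toForm A A η ![Pi.single i 1, Pi.single j 1] := by
  rw [coord₂, toForm_self_apply]
  congr 3
  ext l x
  fin_cases l <;> simp [dotProductBilin]

end ToForm

/-! ### Decomposable elements and determinantal forms -/

section Decomposable

variable {K : Type*} [Field K] {a b : ℕ}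

theorem IsDecomposable.isDetForm {ω : ⋀[K]^a (Fin b → K)} (h : IsDecomposable ω) :
    IsDetForm (toForm K K ω) := by
  obtain ⟨v, rfl⟩ := h
  refine ⟨1, (Matrix.of v).mulVecLin, fun y => ?_⟩
  rw [toForm_ιMulti, one_mul, ← det_transpose]
  congr 1
  ext i j
  exact dotProduct_comm (y i) (v j)

theorem isDecomposable_of_isDetForm {ω : ⋀[K]^(a + 1) (Fin b → K)}
    (h : IsDetForm (toForm K K ω)) : IsDecomposable ω := by
  obtain ⟨c, φ, h⟩ := h
  let v : Fin (a + 1) → Fin b → K := LinearMap.toMatrix' φ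
  -- The scalar is absorbed into the first factor, which exists because the degree is positive.
  refine ⟨Function.update v 0 (c • v 0), ?_⟩
  rw [AlternatingMap.map_update_smul, Function.update_eq_self]
  apply toForm_injective
  ext y
  rw [h, toForm_smul, toForm_ιMulti, ← det_transpose]
  congr 2
  ext i j
  change φ (y j) i = y j ⬝ᵥ v i
  rw [dotProduct_comm]
  exact (congrFun (LinearMap.toMatrix'_mulVec φ (y j)) i).symm

/-- Determinantal forms are characterised by exchange relations at a frame over `k`, and these can
be checked after extending the field. -/
theorem isDetForm_descend {k : Type*} [Field k] [Algebra k K] {ω : ⋀[k]^(a + 1) (Fin b → k)}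
    (h : IsDetForm (toForm k K ω)) : IsDetForm (toForm k k ω) := by
  by_cases hω : toForm k k ω = 0
  · rw [hω]
    exact isDetForm_zero
  obtain ⟨e, he⟩ := exists_apply_ne_zero_of_ne_zero hω
  refine isDetForm_of_exchangeAt he fun v w => ?_
  apply (algebraMap k K).injective
  let f : (Fin b → k) → Fin b → K := fun x j => algebraMap k K (x j)
  have hf : ∀ y, algebraMap k K (toForm k k ω y) = toForm k K ω fun i => f (y i) := fun y =>
    map_toForm (Algebra.ofId k K) ω y
  have h1 := h.exchangeAt (fun i => f (e i)) (f v) fun i => f (w i)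
  have hcons : ∀ x, (fun i => f (vecCons x w i)) = vecCons (f x) fun i => f (w i) := fun x => by
    ext i
    refine Fin.cases ?_ (fun i => ?_) i <;> simp
  have hupd : ∀ i, (fun l => f (Function.update e i v l)) =
      Function.update (fun l => f (e l)) i (f v) := fun i => by
    ext l
    simp only [Function.update_apply]
    split_ifs <;> rfl
  simp only [map_mul, map_sum, hf, hcons, hupd]
  exact h1

end Decomposable

/-! ### Plücker coordinates, duality and the case of `⋀² A⁴` -/

section Coordinates

theorem map_toForm_cons_cons {A B C : Type*} [CommRing A] [CommRing B] [Algebra A B] [CommRing C]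
    [Algebra A C] (f : B →ₐ[A] C) {p n : ℕ} (ω : ⋀[A]^(p + 2) (Fin n → A)) (S : Fin p → Fin n → B)
    (x y : Fin n → B) : f (toForm A B ω (vecCons x (vecCons y S))) =
      toForm A C ω (vecCons (f ∘ x) (vecCons (f ∘ y) fun i => f ∘ S i)) := by
  rw [map_toForm]
  congr 1
  ext i
  refine Fin.cases ?_ (fun i => Fin.cases ?_ (fun i => ?_) i) i <;> simp

theorem ThreeTerm.map {A B C : Type*} [CommRing A] [CommRing B] [Algebra A B] [CommRing C]
    [Algebra A C] (f : B →ₐ[A] C) {p n : ℕ} {ω : ⋀[A]^(p + 2) (Fin n → A)} {S : Fin p → Fin n → B}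
    {a b c d : Fin n → B} (h : ThreeTerm (toForm A B ω) S a b c d) :
    ThreeTerm (toForm A C ω) (fun i => f ∘ S i) (f ∘ a) (f ∘ b) (f ∘ c) (f ∘ d) := by
  have h2 := congrArg f h
  simp only [map_add, map_sub, map_mul, map_zero, map_toForm_cons_cons] at h2
  exact h2

theorem ThreeTerm.of_map {A B C : Type*} [CommRing A] [CommRing B] [Algebra A B] [CommRing C]
    [Algebra A C] (f : B →ₐ[A] C) (hf : Function.Injective f) {p n : ℕ}
    {ω : ⋀[A]^(p + 2) (Fin n → A)} {S : Fin p → Fin n → B} {a b c d : Fin n → B}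
    (h : ThreeTerm (toForm A C ω) (fun i => f ∘ S i) (f ∘ a) (f ∘ b) (f ∘ c) (f ∘ d)) :
    ThreeTerm (toForm A B ω) S a b c d := by
  apply hf
  simp only [map_add, map_sub, map_mul, map_zero, map_toForm_cons_cons]
  exact h

variable {A : Type*} [CommRing A]

theorem stdBasis_repr_dualIso {p q : ℕ} (η : ⋀[A]^p (Fin (p + q) → A))
    (I : Set.powersetCard (Fin (p + q)) p) :
    (stdBasis A q (p + q)).repr (dualIso A p q η)
      (Set.powersetCard.compl (by rw [Fintype.card_fin, Nat.add_comm]) I) =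
    (stdBasis A p (p + q)).repr η I := by
  have : (stdBasis A q (p + q)).coord
      (Set.powersetCard.compl (by rw [Fintype.card_fin, Nat.add_comm]) I) ∘ₗ dualIso A p q =
      (stdBasis A p (p + q)).coord I := by
    refine (stdBasis A p (p + q)).ext fun J => ?_
    rw [LinearMap.comp_apply, dualIso, Module.Basis.constr_basis, Module.Basis.coord_apply,
      Module.Basis.coord_apply, Module.Basis.repr_self, Module.Basis.repr_self,
      Finsupp.single_apply, Finsupp.single_apply]
    simp only [EmbeddingLike.apply_eq_iff_eq]
  exact DFunLike.congr_fun this η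

theorem toForm_dualIso {p q : ℕ} (η : ⋀[A]^p (Fin (p + q) → A)) (f : Fin q ↪o Fin (p + q))
    (g : Fin p ↪o Fin (p + q)) (hfg : ∀ x, x ∈ Set.range f ↔ x ∉ Set.range g) :
    toForm A A (dualIso A p q η) (fun i => Pi.single (f i) 1) =
      toForm A A η fun i => Pi.single (g i) 1 := by
  have h1 := stdBasis_repr_dualIso η (Set.powersetCard.ofFinEmbEquiv g)
  have h2 : Set.powersetCard.compl (by rw [Fintype.card_fin, Nat.add_comm])
      (Set.powersetCard.ofFinEmbEquiv g) = Set.powersetCard.ofFinEmbEquiv f := by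
    apply SetLike.ext
    intro x
    rw [Set.powersetCard.mem_compl, Set.powersetCard.mem_ofFinEmbEquiv_iff_mem_range,
      Set.powersetCard.mem_ofFinEmbEquiv_iff_mem_range, hfg]
  rw [h2, stdBasis_repr, stdBasis_repr, Equiv.symm_apply_apply, Equiv.symm_apply_apply] at h1
  exact h1

/-- The first four standard basis vectors of `A^(q+4)`. -/
def headVec (A : Type*) [CommRing A] (q : ℕ) (i : Fin 4) : Fin (q + 2 + 2) → A :=
  Pi.single (Fin.castLE (by omega) i) 1

/-- The last `q` standard basis vectors of `A^(q+4)`. -/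
def tailVec (A : Type*) [CommRing A] (q : ℕ) (i : Fin q) : Fin (q + 2 + 2) → A :=
  Pi.single i.succ.succ.succ.succ 1

/-- `Z` selects the first four coordinates, and the complement of `{i, j}` among all indices is `{c,
d}` together with the tail. -/
theorem coord₂_map_matZ_dualIso {q : ℕ} (η : ⋀[A]^(q + 2) (Fin (q + 2 + 2) → A))
    (i j c d : Fin 4) (hij : i < j) (hcd : c < d)
    (h : ∀ x : Fin 4, (x = i ∨ x = j) ↔ ¬ (x = c ∨ x = d)) :
    coord₂ i j (exteriorPower.map 2 (matZ A (q + 2)).mulVecLin (dualIso A (q + 2) 2 η)) =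
      toForm A A η (vecCons (headVec A q c) (vecCons (headVec A q d) (tailVec A q))) := by
  let emb : Fin 4 ↪o Fin (q + 2 + 2) := Fin.castLEOrderEmb (by omega)
  let f : Fin 2 ↪o Fin (q + 2 + 2) := OrderEmbedding.ofStrictMono ![emb i, emb j] (by
    rw [Fin.strictMono_iff_lt_succ]
    intro l
    fin_cases l
    exact emb.lt_iff_lt.mpr hij)
  let g : Fin (q + 2) ↪o Fin (q + 2 + 2) := OrderEmbedding.ofStrictMono
    (vecCons (emb c) (vecCons (emb d) fun l : Fin q => l.succ.succ.succ.succ)) (by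
      intro x y
      refine Fin.cases ?_ (fun x => Fin.cases ?_ (fun x => ?_) x) x <;>
      refine Fin.cases ?_ (fun y => Fin.cases ?_ (fun y => ?_) y) y <;>
      intro hxy <;>
      simp only [cons_val_zero, cons_val_succ, Fin.lt_def, Fin.val_succ, Fin.val_zero, emb,
        Fin.castLEOrderEmb_apply, Fin.val_castLE] at hxy hcd ⊢ <;> omega)
  have hfg : ∀ x, x ∈ Set.range f ↔ x ∉ Set.range g := by
    intro x
    have hf : x ∈ Set.range f ↔ x.val = i.val ∨ x.val = j.val := by
      simp only [Set.mem_range, Fin.exists_fin_two]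
      refine or_congr ?_ ?_
      · exact eq_comm.trans Fin.ext_iff
      · exact eq_comm.trans Fin.ext_iff
    have hg : x ∈ Set.range g ↔ x.val = c.val ∨ x.val = d.val ∨ 4 ≤ x.val := by
      rw [Set.mem_range, Fin.exists_fin_succ, Fin.exists_fin_succ]
      refine or_congr (eq_comm.trans Fin.ext_iff) (or_congr (eq_comm.trans Fin.ext_iff) ?_)
      constructor
      · rintro ⟨l, rfl⟩
        exact Nat.le_add_left 4 l.val
      · intro hx
        exact ⟨⟨x.val - 4, by omega⟩, Fin.ext (Nat.sub_add_cancel hx)⟩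
    rw [hf, hg]
    by_cases hx : x.val < 4
    · have := h ⟨x.val, hx⟩
      simp only [Fin.ext_iff] at this
      omega
    · omega
  have key := toForm_dualIso η f g hfg
  rw [coord₂_eq_toForm, toForm_map]
  refine Eq.trans ?_ (key.trans ?_)
  · congr 1
    ext l x
    fin_cases l <;> simp [f, emb, matZ, Pi.single_apply, Fin.ext_iff, eq_comm]
  · congr 1
    ext l x
    refine Fin.cases ?_ (fun l => Fin.cases ?_ (fun l => ?_) l) l <;> rfl

/-- Complementation in four indices swaps the two factors of each product, so the relation keeps its
shape under the sign-free duality. -/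
theorem plucker₄_map_matZ_dualIso_eq_zero_iff {q : ℕ} (η : ⋀[A]^(q + 2) (Fin (q + 2 + 2) → A)) :
    plucker₄ (exteriorPower.map 2 (matZ A (q + 2)).mulVecLin (dualIso A (q + 2) 2 η)) = 0 ↔
      ThreeTerm (toForm A A η) (tailVec A q) (headVec A q 0) (headVec A q 1) (headVec A q 2)
        (headVec A q 3) := by
  rw [plucker₄, coord₂_map_matZ_dualIso η 0 1 2 3 (by decide) (by decide) (by decide),
    coord₂_map_matZ_dualIso η 2 3 0 1 (by decide) (by decide) (by decide),
    coord₂_map_matZ_dualIso η 0 2 1 3 (by decide) (by decide) (by decide),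
    coord₂_map_matZ_dualIso η 1 3 0 2 (by decide) (by decide) (by decide),
    coord₂_map_matZ_dualIso η 0 3 1 2 (by decide) (by decide) (by decide),
    coord₂_map_matZ_dualIso η 1 2 0 3 (by decide) (by decide) (by decide), ThreeTerm]
  ring_nf

theorem toForm_two_four (η : ⋀[A]^2 (Fin 4 → A)) (x y : Fin 4 → A) :
    toForm A A η ![x, y] = (x 0 * y 1 - x 1 * y 0) * coord₂ 0 1 η +
      (x 0 * y 2 - x 2 * y 0) * coord₂ 0 2 η + (x 0 * y 3 - x 3 * y 0) * coord₂ 0 3 η +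
      (x 1 * y 2 - x 2 * y 1) * coord₂ 1 2 η + (x 1 * y 3 - x 3 * y 1) * coord₂ 1 3 η +
      (x 2 * y 3 - x 3 * y 2) * coord₂ 2 3 η := by
  induction η using exteriorPower_induction with
  | h v =>
    have hv : v = ![v 0, v 1] := by ext i; fin_cases i <;> rfl
    rw [hv]
    simp only [coord₂_ιMulti, toForm_ιMulti, det_fin_two, dotProduct, Fin.sum_univ_four, of_apply,
      Algebra.algebraMap_self, RingHom.id_apply, cons_val_zero, cons_val_one]
    ring
  | h0 => simp only [toForm_zero, map_zero, mul_zero, add_zero]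
  | hadd x y hx hy =>
    simp only [toForm_add, map_add, hx, hy]
    ring
  | hsmul r x hx =>
    simp only [toForm_smul, map_smul, hx, smul_eq_mul, Algebra.algebraMap_self, RingHom.id_apply]
    ring

theorem plucker₄_baseChange {B : Type*} [CommRing B] [Algebra A B] (η : ⋀[A]^2 (Fin 4 → A)) :
    plucker₄ (baseChange A B 2 4 η) = algebraMap A B (plucker₄ η) := by
  have h : ∀ i j, coord₂ i j (baseChange A B 2 4 η) = algebraMap A B (coord₂ i j η) := by
    intro i j
    rw [coord₂_eq_toForm, coord₂_eq_toForm, toForm_baseChange]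
    refine Eq.trans ?_ (map_toForm (Algebra.ofId A B) η _).symm
    congr 1
    ext l x
    fin_cases l <;>
    · simp only [Fin.zero_eta, Fin.mk_one, cons_val_zero, cons_val_one, Pi.single_apply]
      split_ifs <;> simp
  simp only [plucker₄, h, map_add, map_sub, map_mul]

theorem isDecomposable_iff_plucker₄ {K : Type*} [Field K] (η : ⋀[K]^2 (Fin 4 → K)) :
    IsDecomposable η ↔ plucker₄ η = 0 := by
  constructor
  · intro h
    have := h.isDetForm.threeTerm ![] (Pi.single 0 1) (Pi.single 1 1) (Pi.single 2 1)
      (Pi.single 3 1)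
    simp only [plucker₄, coord₂_eq_toForm]
    exact this
  · intro h
    refine isDecomposable_of_isDetForm (isDetForm_of_forall_threeTerm fun a b c d => ?_)
    change toForm K K η ![a, b] * toForm K K η ![c, d] -
      toForm K K η ![a, c] * toForm K K η ![b, d] +
      toForm K K η ![a, d] * toForm K K η ![b, c] = 0
    simp only [toForm_two_four]
    unfold plucker₄ at h
    -- The coefficient is the determinant with rows `a`, `b`, `c`, `d`, in its Laplace expansion
    -- along the first two rows.
    linear_combination (
      (a 0 * b 1 - a 1 * b 0) * (c 2 * d 3 - c 3 * d 2)
      - (a 0 * b 2 - a 2 * b 0) * (c 1 * d 3 - c 3 * d 1)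
      + (a 0 * b 3 - a 3 * b 0) * (c 1 * d 2 - c 2 * d 1)
      + (a 1 * b 2 - a 2 * b 1) * (c 0 * d 3 - c 3 * d 0)
      - (a 1 * b 3 - a 3 * b 1) * (c 0 * d 2 - c 2 * d 0)
      + (a 2 * b 3 - a 3 * b 2) * (c 0 * d 1 - c 1 * d 0)) * h

theorem isFracDecomposable_iff_plucker₄ [IsDomain A] (η : ⋀[A]^2 (Fin 4 → A)) :
    IsFracDecomposable η ↔ plucker₄ η = 0 := by
  rw [IsFracDecomposable, isDecomposable_iff_plucker₄, plucker₄_baseChange,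
    FaithfulSMul.algebraMap_eq_zero_iff]

end Coordinates

/-! ### The moment curve and the passage from `H` back to `ω` -/

section MomentCurve

/-- The moment curve `x ↦ (1, x, …, x^(n-1))`. -/
def momentVec {A : Type*} [CommRing A] (n : ℕ) (x : A) : Fin n → A := fun j => x ^ (j : ℕ)

/-- A nonzero functional restricts to a nonzero polynomial on the curve. If the points off `W` lay
in a proper subspace, two such polynomials would have a product vanishing on an infinite field. -/
theorem isGenericSet_momentCurve (K : Type*) [Field K] [Infinite K] (n : ℕ) :
    IsGenericSet K (Set.range (momentVec (A := K) n)) := by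
  have poly : ∀ f : (Fin n → K) →ₗ[K] K, f ≠ 0 →
      ∃ P : Polynomial K, P ≠ 0 ∧ ∀ x, f (momentVec n x) = P.eval x := by
    intro f hf
    refine ⟨∑ j : Fin n, Polynomial.monomial (j : ℕ) (f (Pi.single j 1)), ?_, fun x => ?_⟩
    · intro h
      apply hf
      ext j
      have := congrArg (fun P => Polynomial.coeff P (j : ℕ)) h
      simpa [Polynomial.finsetSum_coeff, Polynomial.coeff_monomial, Fin.val_inj] using this
    · rw [Polynomial.eval_finsetSum, LinearMap.pi_apply_eq_sum_univ f]
      refine Finset.sum_congr rfl fun j _ => ?_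
      rw [Polynomial.eval_monomial, smul_eq_mul, mul_comm, momentVec]
      congr 2
      ext l
      simp [Pi.single_apply, eq_comm]
  intro W hW
  by_contra hW'
  obtain ⟨f, hf, hfW⟩ := Submodule.exists_le_ker_of_lt_top W (lt_top_iff_ne_top.mpr hW)
  obtain ⟨g, hg, hgW⟩ := Submodule.exists_le_ker_of_lt_top _ (lt_top_iff_ne_top.mpr hW')
  obtain ⟨P, hP, hfP⟩ := poly f hf
  obtain ⟨Q, hQ, hgQ⟩ := poly g hg
  apply mul_ne_zero hP hQ
  refine Polynomial.funext fun x => ?_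
  rw [Polynomial.eval_mul, ← hfP, ← hgQ, Polynomial.eval_zero, mul_eq_zero]
  by_cases hx : momentVec n x ∈ W
  · exact Or.inl (hfW hx)
  · exact Or.inr (hgW (Submodule.subset_span ⟨⟨x, rfl⟩, hx⟩))

theorem IsGenericSet.span_eq_top {K V : Type*} [Field K] [AddCommGroup V] [Module K V] {C : Set V}
    (hC : IsGenericSet K C) : Submodule.span K C = ⊤ := by
  by_cases h : (⊥ : Submodule K V) = ⊤
  · exact eq_top_iff.mpr (h ▸ bot_le)
  · exact eq_top_iff.mpr ((hC ⊥ h).ge.trans (Submodule.span_mono Set.sdiff_subset))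

variable {k : Type*} [Field k]

theorem wedgeX_ιMulti (p n : ℕ) (v : Fin p → Fin n → k) : ∃ w,
    wedgeX k p n (ιMulti k p v) = ιMulti (ParamRing k p) p w := by
  rw [wedgeX, baseChange_ιMulti, map_apply_ιMulti]
  exact ⟨_, rfl⟩

theorem IsDecomposable.isFracDecomposable_wedgeX {p n : ℕ} {ω : ⋀[k]^p (Fin n → k)}
    (h : IsDecomposable ω) : IsFracDecomposable (wedgeX k p n ω) := by
  obtain ⟨v, rfl⟩ := h
  obtain ⟨w, hw⟩ := wedgeX_ιMulti p n v
  rw [hw, IsFracDecomposable, baseChange_ιMulti]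
  exact ⟨_, rfl⟩

theorem formH_eq_zero_of_isFracDecomposable_wedgeX {q n : ℕ} {ω : ⋀[k]^(q + 2) (Fin n → k)}
    (h : IsFracDecomposable (wedgeX k (q + 2) n ω)) : formH k (q + 2) n ω = 0 := by
  rw [formH, mapG, plucker₄_map_matZ_dualIso_eq_zero_iff]
  have h1 := IsDecomposable.isDetForm h
  rw [toForm_baseChange] at h1
  exact ThreeTerm.of_map (Algebra.ofId _ (FractionRing (ParamRing k (q + 2))))
    (IsFractionRing.injective _ _) (h1.threeTerm _ _ _ _ _)

theorem toForm_wedgeX_single {p n : ℕ} (ω : ⋀[k]^p (Fin n → k)) (e : Fin p → Fin (p + 2)) :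
    toForm _ _ (wedgeX k p n ω) (fun i => Pi.single (e i) 1) =
      toForm k (ParamRing k p) ω fun i => momentVec n (MvPolynomial.X (e i)) := by
  rw [wedgeX, toForm_map, toForm_baseChange]
  congr 1
  ext i j
  simp [matX, momentVec]

theorem threeTerm_of_formH_eq_zero {q n : ℕ} {ω : ⋀[k]^(q + 2) (Fin n → k)}
    (h : formH k (q + 2) n ω = 0) {K : Type*} [Field K] [Algebra k K] (s : Fin q → K)
    (a b c d : K) : ThreeTerm (toForm k K ω) (fun i => momentVec n (s i)) (momentVec n a)
      (momentVec n b) (momentVec n c) (momentVec n d) := by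
  rw [formH, mapG, plucker₄_map_matZ_dualIso_eq_zero_iff] at h
  let x : Fin (q + 2 + 2) → Fin n → ParamRing k (q + 2) := fun l => momentVec n (MvPolynomial.X l)
  have hx : ThreeTerm (toForm k (ParamRing k (q + 2)) ω) (fun i => x i.succ.succ.succ.succ)
      (x 0) (x 1) (x 2) (x 3) := by
    have h1 : ∀ i j : Fin 4, toForm _ _ (wedgeX k (q + 2) n ω) (vecCons (headVec _ q i)
        (vecCons (headVec _ q j) (tailVec _ q))) = toForm k (ParamRing k (q + 2)) ω
        (vecCons (x (Fin.castLE (by omega) i)) (vecCons (x (Fin.castLE (by omega) j))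
          fun i => x i.succ.succ.succ.succ)) := by
      intro i j
      have h2 := toForm_wedgeX_single ω (vecCons (Fin.castLE (by omega) i)
        (vecCons (Fin.castLE (by omega) j) fun i : Fin q => i.succ.succ.succ.succ))
      refine Eq.trans ?_ (h2.trans ?_) <;> congr 1 <;> ext l : 1 <;>
      refine Fin.cases ?_ (fun l => Fin.cases ?_ (fun l => ?_) l) l <;> rfl
    unfold ThreeTerm at h
    simp only [h1] at h
    exact h
  -- The identity holds at independent variables, so the variables may be set to arbitrary, even
  -- coinciding, values.
  let t : Fin (q + 2 + 2) → K := vecCons a (vecCons b (vecCons c (vecCons d s)))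
  have hmap : ∀ l, MvPolynomial.aeval t ∘ x l = momentVec n (t l) := fun l => by
    ext j
    simp [x, momentVec]
  have := hx.map (MvPolynomial.aeval t)
  simp only [hmap] at this
  exact this

theorem isDecomposable_of_formH_eq_zero {q n : ℕ} {ω : ⋀[k]^(q + 2) (Fin n → k)}
    (h : formH k (q + 2) n ω = 0) : IsDecomposable ω := by
  -- If `k` is finite, its own moment curve may have too few points to be generic.
  have : Infinite (AlgebraicClosure k) := IsAlgClosed.instInfinite
  have hC := isGenericSet_momentCurve (AlgebraicClosure k) n
  refine isDecomposable_of_isDetForm (isDetForm_descend (K := AlgebraicClosure k)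
    (isDetForm_of_threeTerm_generic hC hC.span_eq_top _ ?_))
  rintro S hS _ ⟨a, rfl⟩ _ ⟨b, rfl⟩ _ ⟨c, rfl⟩ _ ⟨d, rfl⟩
  choose s hs using hS
  rw [← funext hs]
  exact threeTerm_of_formH_eq_zero h s a b c d

end MomentCurve

end GrassmannCone

end

theorem mainTheorem3 {k : Type*} [Field k] (p n : ℕ) (hp : 2 ≤ p) (ω : ⋀[k]^p (Fin n → k)) :
    List.TFAE [
      GrassmannCone.IsDecomposable ω,
      GrassmannCone.IsFracDecomposable (GrassmannCone.wedgeX k p n ω),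
      GrassmannCone.IsFracDecomposable (GrassmannCone.mapG k p n ω),
      GrassmannCone.formH k p n ω = 0] := by
  obtain ⟨q, rfl⟩ := Nat.exists_eq_add_of_le' hp
  tfae_have 1 → 2 := GrassmannCone.IsDecomposable.isFracDecomposable_wedgeX
  tfae_have 2 → 4 := GrassmannCone.formH_eq_zero_of_isFracDecomposable_wedgeX
  tfae_have 3 ↔ 4 := GrassmannCone.isFracDecomposable_iff_plucker₄ _
  tfae_have 4 → 1 := GrassmannCone.isDecomposable_of_formH_eq_zero
  tfae_finish
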